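/- All measures are finite Borel measures on $\mathbb{R}$. Fix an effective enumeration $\{I_i\}_{i\in\mathbb{N}}$ of the open intervals with rational endpoints. An open set $U\subseteq\mathbb{R}$ is $\Sigma^0_1$ if $\{i : I_i\subseteq U\}$ is c.e., and an index of this c.e. set is called an index of $U$. A Cauchy name of a real $x$ is a sequence of rationals $\{q_n\}_{n\in\mathbb{N}}$ with $\lim_n q_n=x$ and $|q_n-q_{n+1}|<2^{-n}$ for all $n$; $x$ is computable if it has a computable Cauchy name, and an index of such a name is called an index of $x$. A function $f:\mathbb{R}\to\mathbb{R}$ is computable if there is a Turing functional that maps every Cauchy name of every $x\in\mathbb{R}$ to a Cauchy name of $f(x)$; an index of such a functional is called an index of $f$. Let $C^c_b(\mathbb{R})$ be the set of bounded computable functions $f:\mathbb{R}\to\mathbb{R}$. A function $g:\mathbb{N}\to\mathbb{N}$ is a modulus of convergence of a real sequence $\{a_n\}$ with limit $a$ if $|a_n-a|<2^{-k}$ whenever $n\ge g(k)$. A measure $\mu$ is computable if $\mu(\mathbb{R})$ is a computable real and, from an index of a $\Sigma^0_1$ set $U$, one can compute an index of the (then c.e.) left Dedekind cut $\{q\in\mathbb{Q}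 : q<\mu(U)\}$ of $\mu(U)$. A sequence $\{\mu_n\}_{n\in\mathbb{N}}$ is uniformly computable if $\mu_n$ is computable uniformly in $n$ (an index of the real $\mu_n(\mathbb{R})$ together with an index of such a procedure for $\mu_n$ can be computed from $n$). The sequence $\{\mu_n\}_{n\in\mathbb{N}}$ effectively weakly converges to $\mu$ if $\lim_n\int_{\mathbb{R}} f\,d\mu_n=\int_{\mathbb{R}} f\,d\mu$ for every $f\in C^c_b(\mathbb{R})$, and there is a single algorithm that, from an index of any $f\in C^c_b(\mathbb{R})$ and any $B\in\mathbb{N}$ with $|f|\le B$, computes an index of a modulus of convergence of $\{\int_{\mathbb{R}} f\,d\mu_n\}_{n\in\mathbb{N}}$. Proposition. Let $\{\mu_n\}_{n\in\mathbb{N}}$ be a sequence of finite Borel measures on $\mathbb{R}$ and let $\mu$ be a finite Borel measure on $\mathbb{R}$. If $\{\mu_n\}_{n\in\mathbb{N}}$ is uniformly computable and effectively weakly converges to $\mu$, then $\mu$ is a computable measure. -/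

import Mathlib

open MeasureTheory Filter Topology

namespace EffWeak

/-! ## Programs and indices -/

/-- The partial computable function `ℕ ⇀ ℕ` with index `e`, in Mathlib's numbering of the
partial recursive functions. -/
def phi (e : ℕ) : ℕ →. ℕ := (Denumerable.ofNat Nat.Partrec.Code e).eval

/-- `e` is an index of the c.e. set `S` : the domain of `phi e` is `S`. -/
def IsCEIndex (e : ℕ) (S : Set ℕ) : Prop := ∀ n, (phi e n).Dom ↔ n ∈ S

/-- `e` is an index of the total function `g`. -/
def IsTotalIndex (e : ℕ) (g : ℕ → ℕ) : Prop := ∀ n, g n ∈ phi e n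

/-- Programs for partial recursive functions relative to an oracle `ρ : ℕ → ℕ`.
The constructors are the clauses of `Nat.RecursiveIn`. -/
inductive OracleCode : Type
  | zero : OracleCode
  | succ : OracleCode
  | left : OracleCode
  | right : OracleCode
  | oracle : OracleCode
  | pair : OracleCode → OracleCode → OracleCode
  | comp : OracleCode → OracleCode → OracleCode
  | prec : OracleCode → OracleCode → OracleCode
  | rfind : OracleCode → OracleCode

namespace OracleCode

/-- The partial function computed by an oracle program from the oracle `ρ`. -/
def eval (ρ : ℕ → ℕ) : OracleCode → ℕ →. ℕ
  | zero => fun _ => Part.some 0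
  | succ => fun n => Part.some (n + 1)
  | left => fun n => Part.some n.unpair.1
  | right => fun n => Part.some n.unpair.2
  | oracle => fun n => Part.some (ρ n)
  | pair cf cg => fun n => Nat.pair <$> eval ρ cf n <*> eval ρ cg n
  | comp cf cg => fun n => eval ρ cg n >>= eval ρ cf
  | prec cf cg =>
    Nat.unpaired fun a n =>
      n.rec (eval ρ cf a) fun y IH => do
        let i ← IH
        eval ρ cg (Nat.pair a (Nat.pair y i))
  | rfind cf => fun a =>
      Nat.rfind fun n => (fun m => decide (m = 0)) <$> eval ρ cf (Nat.pair a n)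

/-- The Gödel number of an oracle program. -/
def toNat : OracleCode → ℕ
  | zero => 0
  | succ => 1
  | left => 2
  | right => 3
  | oracle => 4
  | pair cf cg => 4 * Nat.pair cf.toNat cg.toNat + 5
  | comp cf cg => 4 * Nat.pair cf.toNat cg.toNat + 6
  | prec cf cg => 4 * Nat.pair cf.toNat cg.toNat + 7
  | rfind cf => 4 * cf.toNat + 8

theorem toNat_injective : Function.Injective toNat := by
  intro c
  induction c with
  | zero | succ | left | right | oracle =>
    intro d h
    cases d <;> simp only [toNat] at h <;> first | rfl | omega
  | pair a b iha ihb | comp a b iha ihb | prec a b iha ihb =>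
    intro d h
    cases d <;> simp only [toNat] at h <;> try omega
    rename_i c d
    have h' : Nat.pair a.toNat b.toNat = Nat.pair c.toNat d.toNat := by omega
    obtain ⟨h1, h2⟩ := Nat.pair_eq_pair.1 h'
    rw [iha h1, ihb h2]
  | rfind a iha =>
    intro d h
    cases d <;> simp only [toNat] at h <;> try omega
    rename_i c
    have h' : a.toNat = c.toNat := by omega
    rw [iha h']

end OracleCode

/-- The Turing functional with index `e` sends `ρ` to `σ` : the oracle program with Gödel number
`e`, run with oracle `ρ`, halts on every input `n` with output `σ n`. -/
def FunctionalMaps (e : ℕ) (ρ σ : ℕ → ℕ) : Prop :=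
  ∃ c : OracleCode, c.toNat = e ∧ ∀ n, σ n ∈ c.eval ρ n

/-! ## Rationals and rational intervals -/

/-- An effective enumeration of all rationals. -/
def ratOfNat (n : ℕ) : ℚ :=
  ((n.unpair.1.unpair.1 : ℚ) - (n.unpair.1.unpair.2 : ℚ)) / ((n.unpair.2 : ℚ) + 1)

theorem ratOfNat_surjective : Function.Surjective ratOfNat := by
  intro q
  refine ⟨Nat.pair (Nat.pair q.num.toNat (-q.num).toNat) (q.den - 1), ?_⟩
  have h1 : ((q.num.toNat : ℚ) - ((-q.num).toNat : ℚ)) = (q.num : ℚ) := by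
    have : ((q.num.toNat : ℤ) - ((-q.num).toNat : ℤ)) = q.num := by omega
    exact_mod_cast this
  have h2 : ((q.den - 1 : ℕ) : ℚ) + 1 = (q.den : ℚ) := by
    have : q.den - 1 + 1 = q.den := Nat.sub_add_cancel q.pos
    exact_mod_cast this
  simp only [ratOfNat, Nat.unpair_pair, h1, h2]
  exact Rat.num_div_den q

/-- An effective enumeration of all open intervals `(a, b)` with rational `a`, `b`.
The interval is empty when `b ≤ a`. -/
def ratInterval (i : ℕ) : Set ℝ :=
  Set.Ioo ((ratOfNat i.unpair.1 : ℚ) : ℝ) ((ratOfNat i.unpair.2 : ℚ) : ℝ)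

/-- `e` is an index of the `Σ⁰₁` open set `U` : it is an index of `{i | I_i ⊆ U}`. -/
def IsSigmaIndex (e : ℕ) (U : Set ℝ) : Prop :=
  IsOpen U ∧ IsCEIndex e {i | ratInterval i ⊆ U}

/-! ## Computable reals and computable real functions -/

/-- `ρ` is (a numerical presentation of) a Cauchy name of `x`. -/
def IsCauchyName (ρ : ℕ → ℕ) (x : ℝ) : Prop :=
  Tendsto (fun n => ((ratOfNat (ρ n) : ℚ) : ℝ)) atTop (𝓝 x) ∧
    ∀ n, |ratOfNat (ρ n) - ratOfNat (ρ (n + 1))| < (1 / 2 : ℚ) ^ n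

/-- `e` is an index of the computable real `x`. -/
def IsRealIndex (e : ℕ) (x : ℝ) : Prop :=
  ∃ ρ : ℕ → ℕ, IsTotalIndex e ρ ∧ IsCauchyName ρ x

/-- `e` is an index of the left Dedekind cut of `x`, that is, of the left-c.e. real `x`. -/
def IsLeftCutIndex (e : ℕ) (x : ℝ) : Prop :=
  IsCEIndex e {n | ((ratOfNat n : ℚ) : ℝ) < x}

/-- `e` is an index of the computable function `f : ℝ → ℝ` : the Turing functional with index `e`
sends every Cauchy name of every `x` to a Cauchy name of `f x`. -/
def IsFunctionIndex (e : ℕ) (f : ℝ → ℝ) : Prop :=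
  ∀ (x : ℝ) (ρ : ℕ → ℕ), IsCauchyName ρ x →
    ∃ σ : ℕ → ℕ, FunctionalMaps e ρ σ ∧ IsCauchyName σ (f x)

/-- The set of bounded computable functions on `ℝ`. -/
def BoundedComputable : Set (ℝ → ℝ) :=
  {f | (∃ e, IsFunctionIndex e f) ∧ ∃ B : ℝ, ∀ x, |f x| ≤ B}

/-! ## Computable measures -/

/-- `e = ⟨a, b⟩` is an index of the computable measure `μ` : `a` is an index of the real `μ(ℝ)`,
and `phi b` computes an index of the left Dedekind cut of `μ(U)` from any index of any
`Σ⁰₁` set `U`. -/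
def IsMeasureIndex (e : ℕ) (μ : Measure ℝ) : Prop :=
  IsRealIndex e.unpair.1 (μ.real Set.univ) ∧
    ∀ (u : ℕ) (U : Set ℝ), IsSigmaIndex u U →
      ∃ d ∈ phi e.unpair.2 u, IsLeftCutIndex d (μ.real U)

/-- `μ` is a computable measure. -/
def ComputableMeasure (μ : Measure ℝ) : Prop := ∃ e, IsMeasureIndex e μ

/-- `μs n` is a computable measure uniformly in `n`. -/
def UniformlyComputable (μs : ℕ → Measure ℝ) : Prop :=
  ∃ g : ℕ → ℕ, Computable g ∧ ∀ n, IsMeasureIndex (g n) (μs n)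

/-! ## Effective weak convergence -/

/-- `g` is a modulus of convergence of the sequence `a` to the limit `l`. -/
def IsModulus (g : ℕ → ℕ) (a : ℕ → ℝ) (l : ℝ) : Prop :=
  ∀ k n, g k ≤ n → |a n - l| < (1 / 2 : ℝ) ^ k

/-- `μs` effectively weakly converges to `μ` : for every bounded computable `f` the integrals
converge, and one partial computable `h` produces an index of a modulus of convergence of the
integrals from any index `e` of any bounded computable `f` and any bound `B ∈ ℕ` on `|f|`. -/
def EffectivelyWeaklyConverges (μs : ℕ → Measure ℝ) (μ : Measure ℝ) : Prop :=
  (∀ f ∈ BoundedComputable, Tendsto (fun n => ∫ x, f x ∂(μs n)) atTop (𝓝 (∫ x, f x ∂μ))) ∧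
    ∃ h : ℕ × ℕ →. ℕ, Partrec h ∧
      ∀ f ∈ BoundedComputable, ∀ e B : ℕ, IsFunctionIndex e f → (∀ x, |f x| ≤ (B : ℝ)) →
        ∃ m ∈ h (e, B), ∃ g : ℕ → ℕ, IsTotalIndex m g ∧
          IsModulus g (fun n => ∫ x, f x ∂(μs n)) (∫ x, f x ∂μ)

end EffWeak

/-!
Lower bounds for `μ(U)` are enumerated through lower bounds for the measures of rational intervals.

*Intervals.* Let `I` be a rational interval, `f` a trapezoidal function supported in `I` and `J` its
plateau, a rational interval on which `f = 1`. Trapezoids are bounded by `1` and are computable with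
an index computable from rational data, so effective weak convergence yields a computable modulus
for the integrals `∫ f dμₙ`. If `n` is past that modulus at `k` and `p + 2⁻ᵏ < μₙ(J)`, then
`p + 2⁻ᵏ < ∫ f dμₙ < ∫ f dμ + 2⁻ᵏ ≤ μ(I) + 2⁻ᵏ`, so `p < μ(I)`. Such certificates `(f, k, n)` are
enumerable because the `μₙ` are uniformly computable. They exist whenever `p < μ(I)`: with `J` close
to `I`, a second trapezoid supported in `J` has `μ`-integral greater than `p`, and its
`μₙ`-integrals are at most `μₙ(J)` and converge to that value. This is `rePred_lt_measure_ratInterval`.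

*Open sets.* A compact subset of `U` meets finitely many components of `U`, and its trace on each of
them lies in a rational interval inside the component. Hence `μ(U)` is the supremum of the sums
`∑ μ(Iⱼ)` over finite families of pairwise disjoint rational intervals in `U`
(`exists_pairwise_disjoint_ratInterval`). Disjointness is decidable and `Iⱼ ⊆ U` is enumerable from
an index of `U`, so the left cut of `μ(U)` is c.e. uniformly in that index
(`exists_leftCut_of_rePred`).

*Total mass.* The number `μ(ℝ)` is the limit of the integrals `μₙ(ℝ)` of the constant function `1`,
with a computable modulus (`exists_isRealIndex_measure_univ`).

On the side of computability, `rePred_iff_exists_primrecPred` gives the closure properties of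
recursively enumerable predicates, `RatPrimrec` records primitive recursive rational arithmetic, and
`exists_primrec_oracleCode` produces indices of Turing functionals uniformly in a parameter.
-/

namespace EffWeak

/-! ### Recursively enumerable predicates -/

section RecursivelyEnumerable

variable {α β : Type*} [Primcodable α] [Primcodable β]

theorem _root_.REPred.comp {p : β → Prop} (hp : REPred p) {f : α → β} (hf : Computable f) :
    REPred fun a => p (f a) :=
  Partrec.comp hp hf

theorem _root_.PrimrecPred.rePred {p : α → Prop} (hp : PrimrecPred p) : REPred p := by
  obtain ⟨_, hp⟩ := hp
  exact ComputablePred.to_re ⟨inferInstance, hp.to_comp⟩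

/-- The graph of a partial recursive function is the projection of a primitive recursive
predicate: the extra argument bounds the running time. -/
theorem exists_primrecPred_mem_iff {f : α →. β} (hf : Partrec f) :
    ∃ R : (α × β) × ℕ → Prop, PrimrecPred R ∧ ∀ x, x.2 ∈ f x.1 ↔ ∃ n, R (x, n) := by
  obtain ⟨c, hc⟩ := Nat.Partrec.Code.exists_code.1 hf
  refine ⟨fun x => Nat.Partrec.Code.evaln x.2 c (Encodable.encode x.1.1)
    = some (Encodable.encode x.1.2), ?_, ?_⟩
  · exact Primrec.eq.comp
      (Nat.Partrec.Code.primrec_evaln.comp (((Primrec.snd).pair (Primrec.const c)).pair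
        (Primrec.encode.comp (Primrec.fst.comp Primrec.fst))))
      (Primrec.option_some.comp (Primrec.encode.comp (Primrec.snd.comp Primrec.fst)))
  · rintro ⟨a, b⟩
    have := Nat.Partrec.Code.evaln_complete (c := c) (n := Encodable.encode a)
      (x := Encodable.encode b)
    simp only [hc, Encodable.encodek, Part.coe_some, Part.bind_some, Part.mem_map_iff,
      Encodable.encode_inj, exists_eq_right, Option.mem_def] at this
    exact this

/-- A predicate is recursively enumerable iff it is the projection of a primitive recursive
predicate. -/
theorem rePred_iff_exists_primrecPred {p : α → Prop} :
    REPred p ↔ ∃ R : α × ℕ → Prop, PrimrecPred R ∧ ∀ a, p a ↔ ∃ n, R (a, n) := by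
  constructor
  · intro hp
    obtain ⟨R, hR, h⟩ := exists_primrecPred_mem_iff hp
    refine ⟨fun x => R ((x.1, ()), x.2), hR.comp
      ((Primrec.fst.pair (Primrec.const ())).pair Primrec.snd), fun a => ?_⟩
    rw [← h (a, ())]
    simp
  · rintro ⟨R, ⟨_, hR⟩, h⟩
    have : Partrec fun a => Nat.rfind fun n => Part.some (decide (R (a, n))) :=
      Partrec.rfind (hR.to_comp.partrec.to₂)
    refine this.dom_re.of_eq fun a => ?_
    rw [h]
    exact Nat.rfind_dom.trans (by simp)

theorem _root_.REPred.and {p q : α → Prop} (hp : REPred p) (hq : REPred q) :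
    REPred fun a => p a ∧ q a := by
  have : Partrec fun a => (Part.assert (p a) fun _ => Part.some ()).bind fun _ =>
      Part.assert (q a) fun _ => Part.some () :=
    Partrec.bind hp (hq.comp Computable.fst : REPred fun x : α × Unit => q x.1).to₂
  refine this.dom_re.of_eq fun a => ?_
  simp [Part.assert]

theorem _root_.REPred.exists {p : α → β → Prop} (hp : REPred fun x : α × β => p x.1 x.2) :
    REPred fun a => ∃ b, p a b := by
  obtain ⟨R, hR, h⟩ := rePred_iff_exists_primrecPred.1 hp
  obtain ⟨_, hR⟩ := hR
  -- the witness `n` codes a pair of an element of `β` and a witness for `R`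
  refine rePred_iff_exists_primrecPred.2
    ⟨fun x => ((Encodable.decode (α := β × ℕ) x.2).map
      fun y => decide (R ((x.1, y.1), y.2))) = some true, ?_, fun a => ?_⟩
  · refine Primrec.eq.comp (Primrec.option_map (Primrec.decode.comp Primrec.snd) ?_)
      (Primrec.const _)
    exact hR.comp (((Primrec.fst.comp Primrec.fst).pair (Primrec.fst.comp Primrec.snd)).pair
      (Primrec.snd.comp Primrec.snd))
  · constructor
    · rintro ⟨b, hb⟩
      obtain ⟨n, hn⟩ := (h (a, b)).1 hb
      exact ⟨Encodable.encode (b, n), by simp [hn]⟩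
    · rintro ⟨n, hn⟩
      simp only [Option.map_eq_some_iff, decide_eq_true_eq] at hn
      obtain ⟨y, -, hy⟩ := hn
      exact ⟨y.1, (h (a, y.1)).2 ⟨_, hy⟩⟩

theorem _root_.REPred.forall_mem_list {p : α × β → Prop} (hp : REPred p) :
    REPred fun x : α × List β => ∀ b ∈ x.2, p (x.1, b) := by
  obtain ⟨R, hR, h⟩ := rePred_iff_exists_primrecPred.1 hp
  have h1 : PrimrecRel fun (n : ℕ) (x : α × β) => R (x, n) :=
    hR.comp (Primrec.snd.pair Primrec.fst)
  have h2 : PrimrecRel fun (b : β) (y : α × ℕ) => ∃ n ∈ List.range y.2, R ((y.1, b), n) :=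
    h1.exists_mem_list.comp (Primrec.list_range.comp (Primrec.snd.comp Primrec.snd))
      ((Primrec.fst.comp Primrec.snd).pair Primrec.fst)
  refine rePred_iff_exists_primrecPred.2 ⟨fun x => ∀ b ∈ x.1.2, ∃ n ∈ List.range x.2,
    R ((x.1.1, b), n), h2.forall_mem_list.comp (Primrec.snd.comp Primrec.fst)
      ((Primrec.fst.comp Primrec.fst).pair Primrec.snd), ?_⟩
  rintro ⟨a, L⟩
  simp only [h, List.mem_range]
  constructor
  · intro H
    induction L with
    | nil => exact ⟨0, by simp⟩
    | cons b L ih =>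
      obtain ⟨N, hN⟩ := ih fun b hb => H b (List.mem_cons_of_mem _ hb)
      obtain ⟨n, hn⟩ := H b List.mem_cons_self
      refine ⟨max N (n + 1), fun c hc => ?_⟩
      rcases List.mem_cons.1 hc with rfl | hc
      · exact ⟨n, by omega, hn⟩
      · obtain ⟨m, hm, hm'⟩ := hN c hc
        exact ⟨m, by omega, hm'⟩
  · rintro ⟨N, hN⟩ b hb
    obtain ⟨n, -, hn⟩ := hN b hb
    exact ⟨n, hn⟩

end RecursivelyEnumerable

/-! ### Indices -/

theorem partrec₂_phi : Partrec₂ phi :=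
  Nat.Partrec.Code.eval_part.comp ((Computable.ofNat Nat.Partrec.Code).comp Computable.fst)
    Computable.snd

theorem exists_phi_eq {f : ℕ →. ℕ} (hf : Partrec f) : ∃ e, phi e = f := by
  obtain ⟨c, hc⟩ := Nat.Partrec.Code.exists_code.1 (Partrec.nat_iff.1 hf)
  exact ⟨Encodable.encode c, by rw [phi, Denumerable.ofNat_encode, hc]⟩

theorem exists_isTotalIndex {g : ℕ → ℕ} (hg : Computable g) : ∃ e, IsTotalIndex e g := by
  obtain ⟨e, he⟩ := exists_phi_eq hg.partrec
  exact ⟨e, fun n => by rw [he]; exact Part.mem_some _⟩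

/-- The s-m-n theorem for c.e. sets. -/
theorem exists_computable_isCEIndex {p : ℕ × ℕ → Prop} (hp : REPred p) :
    ∃ d : ℕ → ℕ, Computable d ∧ ∀ u, IsCEIndex (d u) {n | p (u, n)} := by
  have hf : Partrec fun m : ℕ => (Part.assert (p m.unpair) fun _ => Part.some ()).map
      fun _ => 0 :=
    Partrec.map (hp.comp Primrec.unpair.to_comp) (Computable.const 0).to₂
  obtain ⟨c, hc⟩ := Nat.Partrec.Code.exists_code.1 (Partrec.nat_iff.1 hf)
  refine ⟨fun u => Encodable.encode (c.curry u), Computable.encode.comp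
    (Nat.Partrec.Code.primrec₂_curry.to_comp.comp (Computable.const c) Computable.id),
    fun u n => ?_⟩
  rw [phi, Denumerable.ofNat_encode, Nat.Partrec.Code.eval_curry, hc]
  simp [Part.assert]

/-! ### Primitive recursive rational arithmetic -/

/-- `F` is primitive recursive as a rational-valued function: some primitive recursive function
computes a code of `F a`, in the enumeration `ratOfNat`, from `a`. -/
def RatPrimrec {α : Type*} [Primcodable α] (F : α → ℚ) : Prop :=
  ∃ f : α → ℕ, Primrec f ∧ ∀ a, ratOfNat (f a) = F a

section RatPrimrec

variable {α β : Type*} [Primcodable α] [Primcodable β] {F G : α → ℚ}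

/-- The code of `(a - b) / (c + 1)`. -/
def ratCode (a b c : ℕ) : ℕ := Nat.pair (Nat.pair a b) c

theorem ratOfNat_ratCode (a b c : ℕ) :
    ratOfNat (ratCode a b c) = ((a : ℚ) - b) / ((c : ℚ) + 1) := by
  simp [ratOfNat, ratCode]

theorem primrec_ratCode {f g h : α → ℕ} (hf : Primrec f) (hg : Primrec g) (hh : Primrec h) :
    Primrec fun a => ratCode (f a) (g a) (h a) :=
  Primrec₂.natPair.comp (Primrec₂.natPair.comp hf hg) hh

theorem primrec_unpair_fst : Primrec fun n : ℕ => n.unpair.1 := Primrec.fst.comp Primrec.unpair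

theorem primrec_unpair_snd : Primrec fun n : ℕ => n.unpair.2 := Primrec.snd.comp Primrec.unpair

theorem primrec_two_pow : Primrec fun n : ℕ => 2 ^ n := by
  refine (Primrec.nat_rec₁ 1 (f := fun _ m => 2 * m)
    (Primrec.nat_mul.comp (Primrec.const 2) Primrec.snd).to₂).of_eq fun n => ?_
  induction n with
  | zero => rfl
  | succ n ih => simp only [ih, pow_succ]; ring

namespace RatPrimrec

theorem comp (hF : RatPrimrec F) {g : β → α} (hg : Primrec g) : RatPrimrec fun b => F (g b) := by
  obtain ⟨f, hf, h⟩ := hF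
  exact ⟨fun b => f (g b), hf.comp hg, fun b => h _⟩

theorem ofNat : RatPrimrec ratOfNat := ⟨id, Primrec.id, fun _ => rfl⟩

theorem const (q : ℚ) : RatPrimrec fun _ : α => q := by
  obtain ⟨n, hn⟩ := ratOfNat_surjective q
  exact ⟨fun _ => n, Primrec.const n, fun _ => hn⟩

/-- Every primitive recursive rational function is a primitive recursive fraction. -/
theorem exists_eq_div (hF : RatPrimrec F) : ∃ a b c : α → ℕ, Primrec a ∧ Primrec b ∧ Primrec c ∧
    ∀ x, F x = ((a x : ℚ) - b x) / ((c x : ℚ) + 1) := by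
  obtain ⟨f, hf, h⟩ := hF
  refine ⟨fun x => (f x).unpair.1.unpair.1, fun x => (f x).unpair.1.unpair.2,
    fun x => (f x).unpair.2, ?_, ?_, ?_, fun x => (h x).symm⟩
  · exact primrec_unpair_fst.comp (primrec_unpair_fst.comp hf)
  · exact primrec_unpair_snd.comp (primrec_unpair_fst.comp hf)
  · exact primrec_unpair_snd.comp hf

theorem neg (hF : RatPrimrec F) : RatPrimrec fun x => -F x := by
  obtain ⟨a, b, c, ha, hb, hc, h⟩ := hF.exists_eq_div
  refine ⟨fun x => ratCode (b x) (a x) (c x), primrec_ratCode hb ha hc, fun x => ?_⟩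
  simp only [ratOfNat_ratCode, h]
  ring

theorem add (hF : RatPrimrec F) (hG : RatPrimrec G) : RatPrimrec fun x => F x + G x := by
  obtain ⟨a, b, c, ha, hb, hc, h⟩ := hF.exists_eq_div
  obtain ⟨a', b', c', ha', hb', hc', h'⟩ := hG.exists_eq_div
  have hs := Primrec.succ.comp hc
  have hs' := Primrec.succ.comp hc'
  refine ⟨fun x => ratCode (a x * (c' x + 1) + a' x * (c x + 1))
    (b x * (c' x + 1) + b' x * (c x + 1)) (c x * c' x + c x + c' x), primrec_ratCode
    (Primrec.nat_add.comp (Primrec.nat_mul.comp ha hs') (Primrec.nat_mul.comp ha' hs))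
    (Primrec.nat_add.comp (Primrec.nat_mul.comp hb hs') (Primrec.nat_mul.comp hb' hs))
    (Primrec.nat_add.comp (Primrec.nat_add.comp (Primrec.nat_mul.comp hc hc') hc) hc'),
    fun x => ?_⟩
  have e : ((c x : ℚ) * c' x + c x + c' x) + 1 = (c x + 1) * (c' x + 1) := by ring
  simp only [ratOfNat_ratCode, h, h']
  push_cast
  rw [e, div_add_div _ _ (by positivity) (by positivity)]
  ring

theorem sub (hF : RatPrimrec F) (hG : RatPrimrec G) : RatPrimrec fun x => F x - G x := by
  simpa only [sub_eq_add_neg] using hF.add hG.neg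

theorem two_pow_mul {t : α → ℕ} (ht : Primrec t) (hF : RatPrimrec F) :
    RatPrimrec fun x => 2 ^ t x * F x := by
  obtain ⟨a, b, c, ha, hb, hc, h⟩ := hF.exists_eq_div
  have hp := primrec_two_pow.comp ht
  refine ⟨fun x => ratCode (2 ^ t x * a x) (2 ^ t x * b x) (c x), primrec_ratCode
    (Primrec.nat_mul.comp hp ha) (Primrec.nat_mul.comp hp hb) hc, fun x => ?_⟩
  simp only [ratOfNat_ratCode, h]
  push_cast
  ring

theorem half_pow {t : α → ℕ} (ht : Primrec t) : RatPrimrec fun x => (1 / 2 : ℚ) ^ t x := by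
  refine ⟨fun x => ratCode 1 0 (2 ^ t x - 1), primrec_ratCode (Primrec.const 1) (Primrec.const 0)
    (Primrec.pred.comp (primrec_two_pow.comp ht)), fun x => ?_⟩
  have h : (((2 ^ t x - 1 : ℕ) : ℚ) + 1) = 2 ^ t x := by
    have : 2 ^ t x - 1 + 1 = 2 ^ t x := Nat.sub_add_cancel Nat.one_le_two_pow
    exact_mod_cast this
  rw [ratOfNat_ratCode, h]
  simp

theorem le (hF : RatPrimrec F) (hG : RatPrimrec G) : PrimrecPred fun x => F x ≤ G x := by
  obtain ⟨a, b, c, ha, hb, hc, h⟩ := hF.exists_eq_div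
  obtain ⟨a', b', c', ha', hb', hc', h'⟩ := hG.exists_eq_div
  have hs := Primrec.succ.comp hc
  have hs' := Primrec.succ.comp hc'
  refine (Primrec.nat_le.comp
    (Primrec.nat_add.comp (Primrec.nat_mul.comp ha hs') (Primrec.nat_mul.comp hb' hs))
    (Primrec.nat_add.comp (Primrec.nat_mul.comp ha' hs) (Primrec.nat_mul.comp hb hs'))).of_eq
    fun x => ?_
  rw [h, h', div_le_div_iff₀ (by positivity) (by positivity)]
  rw [← Nat.cast_le (α := ℚ)]
  push_cast
  constructor <;> intro H <;> linarith

theorem lt (hF : RatPrimrec F) (hG : RatPrimrec G) : PrimrecPred fun x => F x < G x :=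
  (hG.le hF).not.of_eq fun _ => not_le

theorem ite {p : α → Prop} [DecidablePred p] (hp : PrimrecPred p) (hF : RatPrimrec F)
    (hG : RatPrimrec G) : RatPrimrec fun x => if p x then F x else G x := by
  obtain ⟨f, hf, h⟩ := hF
  obtain ⟨g, hg, h'⟩ := hG
  refine ⟨fun x => if p x then f x else g x, Primrec.ite hp hf hg, fun x => ?_⟩
  beta_reduce
  split_ifs
  exacts [h x, h' x]

theorem max (hF : RatPrimrec F) (hG : RatPrimrec G) : RatPrimrec fun x => max (F x) (G x) := by
  simpa only [max_def] using ite (hF.le hG) hG hF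

theorem min (hF : RatPrimrec F) (hG : RatPrimrec G) : RatPrimrec fun x => min (F x) (G x) := by
  simpa only [min_def] using ite (hF.le hG) hF hG

theorem list_sum (hF : RatPrimrec F) : RatPrimrec fun L : List α => (L.map F).sum := by
  obtain ⟨f, hf, h⟩ := hF
  obtain ⟨s, hs, h'⟩ := (ofNat.comp Primrec.fst).add (ofNat.comp Primrec.snd)
  refine ⟨fun L => L.foldr (fun x m => s (f x, m)) (ratCode 0 0 0), ?_, fun L => ?_⟩
  · refine Primrec.list_foldr Primrec.id (Primrec.const _)
      (h := fun _ y => s (f y.1, y.2)) ?_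
    exact hs.comp ((hf.comp (Primrec.fst.comp Primrec.snd)).pair (Primrec.snd.comp Primrec.snd))
  · induction L with
    | nil => simp [ratOfNat_ratCode]
    | cons x L ih => simp only [List.foldr_cons, h', ih, h, List.map_cons, List.sum_cons]

end RatPrimrec

end RatPrimrec

/-! ### Oracle programs -/

theorem OracleCode.eval_comp {ρ : ℕ → ℕ} {cf cg : OracleCode} {n m : ℕ}
    (h : cg.eval ρ n = Part.some m) : (OracleCode.comp cf cg).eval ρ n = cf.eval ρ m := by
  simp only [eval, h]
  exact Part.bind_some _ _

theorem OracleCode.eval_pair {ρ : ℕ → ℕ} {cf cg : OracleCode} {n m k : ℕ}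
    (hf : cf.eval ρ n = Part.some m) (hg : cg.eval ρ n = Part.some k) :
    (OracleCode.pair cf cg).eval ρ n = Part.some (Nat.pair m k) := by
  simp [eval, hf, hg, Seq.seq]

theorem OracleCode.exists_eval_eq {f : ℕ → ℕ} (hf : Nat.Primrec f) :
    ∃ c : OracleCode, ∀ ρ n, c.eval ρ n = Part.some (f n) := by
  induction hf with
  | zero => exact ⟨.zero, fun _ _ => rfl⟩
  | succ => exact ⟨.succ, fun _ _ => rfl⟩
  | left => exact ⟨.left, fun _ _ => rfl⟩
  | right => exact ⟨.right, fun _ _ => rfl⟩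
  | pair _ _ ihf ihg =>
    obtain ⟨cf, hf⟩ := ihf
    obtain ⟨cg, hg⟩ := ihg
    exact ⟨.pair cf cg, fun ρ n => OracleCode.eval_pair (hf ρ n) (hg ρ n)⟩
  | comp _ _ ihf ihg =>
    obtain ⟨cf, hf⟩ := ihf
    obtain ⟨cg, hg⟩ := ihg
    exact ⟨.comp cf cg, fun ρ n => (OracleCode.eval_comp (hg ρ n)).trans (hf ρ _)⟩
  | prec _ _ ihf ihg =>
    obtain ⟨cf, hf⟩ := ihf
    obtain ⟨cg, hg⟩ := ihg
    refine ⟨.prec cf cg, fun ρ n => ?_⟩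
    simp only [eval, Nat.unpaired]
    induction n.unpair.2 with
    | zero => exact hf _ _
    | succ m ih =>
      simp only [ih]
      simp [hg]

/-- The oracle program computing the constant function `n`. -/
def OracleCode.const : ℕ → OracleCode
  | 0 => .zero
  | n + 1 => .comp .succ (const n)

theorem OracleCode.eval_const (ρ : ℕ → ℕ) (n m : ℕ) :
    (OracleCode.const n).eval ρ m = Part.some n := by
  induction n with
  | zero => rfl
  | succ n ih => exact OracleCode.eval_comp ih

theorem OracleCode.primrec_toNat_const : Primrec fun n => (OracleCode.const n).toNat := by
  refine (Primrec.nat_rec₁ 0 (f := fun _ m => 4 * Nat.pair 1 m + 6)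
    (Primrec.nat_add.comp (Primrec.nat_mul.comp (Primrec.const 4)
      (Primrec₂.natPair.comp (Primrec.const 1) Primrec.snd)) (Primrec.const 6)).to₂).of_eq
    fun n => ?_
  induction n with
  | zero => rfl
  | succ n ih => simp only [ih, const, toNat]

/-- Uniformly in a parameter `v`, an oracle program that reads a single value `ρ (s (v, n))` of the
oracle and processes it by a primitive recursive function. -/
theorem exists_primrec_oracleCode {F : ℕ → ℕ → ℕ} (hF : Primrec₂ F) {s : ℕ → ℕ → ℕ}
    (hs : Primrec₂ s) : ∃ e : ℕ → ℕ, Primrec e ∧ ∀ (v : ℕ) (ρ : ℕ → ℕ),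
      FunctionalMaps (e v) ρ fun n => F v (ρ (s v n)) := by
  obtain ⟨cF, hcF⟩ := OracleCode.exists_eval_eq (Primrec₂.unpaired'.2 hF)
  obtain ⟨cs, hcs⟩ := OracleCode.exists_eval_eq (Primrec₂.unpaired'.2 hs)
  let D : OracleCode := .comp cF (.pair .left (.comp .oracle cs))
  let c : ℕ → OracleCode := fun v => .comp D (.pair (.const v) (.pair .left .right))
  refine ⟨fun v => (c v).toNat, ?_, fun v ρ => ⟨c v, rfl, fun n => ?_⟩⟩
  · simp only [c, OracleCode.toNat]
    exact Primrec.nat_add.comp (Primrec.nat_mul.comp (Primrec.const 4) (Primrec₂.natPair.comp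
      (Primrec.const _) (Primrec.nat_add.comp (Primrec.nat_mul.comp (Primrec.const 4)
        (Primrec₂.natPair.comp OracleCode.primrec_toNat_const (Primrec.const _)))
        (Primrec.const 5)))) (Primrec.const 6)
  · have h1 : (c v).eval ρ n = D.eval ρ (Nat.pair v n) := by
      rw [OracleCode.eval_comp (OracleCode.eval_pair (OracleCode.eval_const ρ v n)
        (OracleCode.eval_pair rfl rfl)), Nat.pair_unpair]
    have h2 : (OracleCode.comp .oracle cs).eval ρ (Nat.pair v n) = Part.some (ρ (s v n)) := by
      rw [OracleCode.eval_comp (hcs ρ _), OracleCode.eval, Nat.unpaired, Nat.unpair_pair]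
    rw [h1, OracleCode.eval_comp (OracleCode.eval_pair rfl h2), hcF]
    simp

/-! ### Trapezoidal functions -/

/-- The trapezoidal function of height `1` and slope `2 ^ t` supported on `[a, b]`. It is defined
over any ordered field, to be evaluated both at rational and at real arguments. -/
def trapezoid {K : Type*} [Field K] [LinearOrder K] (a b : K) (t : ℕ) (x : K) : K :=
  max 0 (min 1 (min (2 ^ t * (x - a)) (2 ^ t * (b - x))))

theorem trapezoid_cast (a b : ℚ) (t : ℕ) (x : ℚ) :
    ((trapezoid a b t x : ℚ) : ℝ) = trapezoid (a : ℝ) (b : ℝ) t (x : ℝ) := by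
  simp [trapezoid]

theorem abs_trapezoid_sub_le (a b : ℚ) (t : ℕ) (x y : ℚ) :
    |trapezoid a b t x - trapezoid a b t y| ≤ 2 ^ t * |x - y| := by
  have h1 : |2 ^ t * (x - a) - 2 ^ t * (y - a)| = 2 ^ t * |x - y| := by
    rw [← mul_sub, abs_mul, abs_of_pos (by positivity : (0 : ℚ) < 2 ^ t)]
    ring_nf
  have h2 : |2 ^ t * (b - x) - 2 ^ t * (b - y)| = 2 ^ t * |x - y| := by
    rw [← mul_sub, abs_mul, abs_of_pos (by positivity : (0 : ℚ) < 2 ^ t), abs_sub_comm x y]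
    ring_nf
  have h0 : 0 ≤ 2 ^ t * |x - y| := by positivity
  refine (abs_max_sub_max_le_max _ _ _ _).trans (max_le (by simp) ?_)
  refine (abs_min_sub_min_le_max _ _ _ _).trans (max_le (by simp) ?_)
  exact (abs_min_sub_min_le_max _ _ _ _).trans (max_le h1.le h2.le)

theorem continuous_trapezoid (a b : ℝ) (t : ℕ) : Continuous (trapezoid a b t) := by
  unfold trapezoid
  fun_prop

theorem trapezoid_nonneg (a b : ℝ) (t : ℕ) (x : ℝ) : 0 ≤ trapezoid a b t x := le_max_left _ _

theorem trapezoid_le_one (a b : ℝ) (t : ℕ) (x : ℝ) : trapezoid a b t x ≤ 1 :=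
  max_le zero_le_one (min_le_left _ _)

theorem abs_trapezoid_le_one (a b : ℝ) (t : ℕ) (x : ℝ) : |trapezoid a b t x| ≤ 1 := by
  rw [abs_of_nonneg (trapezoid_nonneg ..)]
  exact trapezoid_le_one ..

theorem trapezoid_eq_zero {a b x : ℝ} (t : ℕ) (hx : x ∉ Set.Ioo a b) : trapezoid a b t x = 0 := by
  refine max_eq_left ((min_le_right _ _).trans ?_)
  by_cases h : a < x
  · have hb : b ≤ x := not_lt.1 fun hb => hx ⟨h, hb⟩
    exact (min_le_right _ _).trans (mul_nonpos_of_nonneg_of_nonpos (by positivity) (by linarith))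
  · exact (min_le_left _ _).trans (mul_nonpos_of_nonneg_of_nonpos (by positivity) (by linarith))

theorem trapezoid_eq_one {a b x : ℝ} {t : ℕ}
    (hx : x ∈ Set.Ioo (a + (1 / 2) ^ t) (b - (1 / 2) ^ t)) : trapezoid a b t x = 1 := by
  have h : (2 : ℝ) ^ t * (1 / 2) ^ t = 1 := by rw [← mul_pow]; norm_num
  obtain ⟨h1, h2⟩ := hx
  have h3 : 1 ≤ 2 ^ t * (x - a) := by
    rw [← h]
    gcongr
    linarith
  have h4 : 1 ≤ 2 ^ t * (b - x) := by
    rw [← h]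
    gcongr
    linarith
  rw [trapezoid, min_eq_left (le_min h3 h4), max_eq_right zero_le_one]

section Integral

variable (ν : Measure ℝ) [IsFiniteMeasure ν] (a b : ℝ) (t : ℕ)

theorem integrable_trapezoid : Integrable (trapezoid a b t) ν :=
  Integrable.of_bound (continuous_trapezoid a b t).aestronglyMeasurable 1
    (ae_of_all _ fun x => by simpa using abs_trapezoid_le_one a b t x)

theorem integral_trapezoid_le : ∫ x, trapezoid a b t x ∂ν ≤ ν.real (Set.Ioo a b) := by
  rw [← integral_indicator_one measurableSet_Ioo]
  refine integral_mono (integrable_trapezoid ν a b t)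
    ((integrable_const 1).indicator measurableSet_Ioo) fun x => ?_
  by_cases hx : x ∈ Set.Ioo a b
  · simpa [hx] using trapezoid_le_one a b t x
  · simp [Set.indicator_of_notMem hx, trapezoid_eq_zero t hx]

theorem measureReal_le_integral_trapezoid :
    ν.real (Set.Ioo (a + (1 / 2) ^ t) (b - (1 / 2) ^ t)) ≤ ∫ x, trapezoid a b t x ∂ν := by
  rw [← integral_indicator_one measurableSet_Ioo]
  refine integral_mono ((integrable_const 1).indicator measurableSet_Ioo)
    (integrable_trapezoid ν a b t) fun x => ?_
  by_cases hx : x ∈ Set.Ioo (a + (1 / 2) ^ t) (b - (1 / 2) ^ t)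
  · rw [Set.indicator_of_mem hx, trapezoid_eq_one hx]; rfl
  · rw [Set.indicator_of_notMem hx]; exact trapezoid_nonneg a b t x

theorem exists_lt_measureReal_Ioo {q : ℝ} (hq : q < ν.real (Set.Ioo a b)) :
    ∃ t : ℕ, q < ν.real (Set.Ioo (a + (1 / 2) ^ t) (b - (1 / 2) ^ t)) := by
  have hpow : Tendsto (fun t : ℕ => (1 / 2 : ℝ) ^ t) atTop (𝓝 0) :=
    tendsto_pow_atTop_nhds_zero_of_lt_one (by norm_num) (by norm_num)
  have hmono : Monotone fun t : ℕ => Set.Ioo (a + (1 / 2) ^ t) (b - (1 / 2) ^ t) := by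
    intro s t hst
    have : (1 / 2 : ℝ) ^ t ≤ (1 / 2) ^ s := pow_le_pow_of_le_one (by norm_num) (by norm_num) hst
    exact Set.Ioo_subset_Ioo (by linarith) (by linarith)
  have hU : ⋃ t : ℕ, Set.Ioo (a + (1 / 2) ^ t) (b - (1 / 2) ^ t) = Set.Ioo a b := by
    ext x
    simp only [Set.mem_iUnion]
    constructor
    · rintro ⟨t, h1, h2⟩
      have : (0 : ℝ) < (1 / 2) ^ t := by positivity
      exact ⟨by linarith, by linarith⟩
    · rintro ⟨h1, h2⟩
      obtain ⟨t, ht⟩ := (hpow.eventually_lt_const (lt_min (sub_pos.2 h1) (sub_pos.2 h2))).exists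
      obtain ⟨h3, h4⟩ := lt_min_iff.1 ht
      exact ⟨t, by linarith, by linarith⟩
  have hlim := tendsto_measure_iUnion_atTop (μ := ν) hmono
  rw [hU] at hlim
  have hlim' := (ENNReal.tendsto_toReal (measure_ne_top ν _)).comp hlim
  exact (hlim'.eventually_const_lt hq).exists

end Integral

/-! ### Computability of trapezoidal functions and of rational intervals -/

/-- The left endpoint of the rational interval with number `i`. -/
def leftEnd (i : ℕ) : ℚ := ratOfNat i.unpair.1

/-- The right endpoint of the rational interval with number `i`. -/
def rightEnd (i : ℕ) : ℚ := ratOfNat i.unpair.2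

theorem ratInterval_eq (i : ℕ) :
    ratInterval i = Set.Ioo ((leftEnd i : ℚ) : ℝ) ((rightEnd i : ℚ) : ℝ) := rfl

theorem ratPrimrec_leftEnd : RatPrimrec leftEnd := RatPrimrec.ofNat.comp primrec_unpair_fst

theorem ratPrimrec_rightEnd : RatPrimrec rightEnd := RatPrimrec.ofNat.comp primrec_unpair_snd

theorem exists_ratInterval_eq (a b : ℚ) : ∃ i, leftEnd i = a ∧ rightEnd i = b := by
  obtain ⟨m, rfl⟩ := ratOfNat_surjective a
  obtain ⟨n, rfl⟩ := ratOfNat_surjective b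
  exact ⟨Nat.pair m n, by simp [leftEnd], by simp [rightEnd]⟩

theorem exists_primrec_isFunctionIndex : ∃ e : ℕ × ℕ → ℕ, Primrec e ∧
    ∀ i t, IsFunctionIndex (e (i, t))
      (trapezoid ((leftEnd i : ℚ) : ℝ) ((rightEnd i : ℚ) : ℝ) t) := by
  have hi : Primrec fun x : ℕ × ℕ => x.1.unpair.1 := primrec_unpair_fst.comp Primrec.fst
  have ht : Primrec fun x : ℕ × ℕ => x.1.unpair.2 := primrec_unpair_snd.comp Primrec.fst
  have hx : RatPrimrec fun x : ℕ × ℕ => ratOfNat x.2 := RatPrimrec.ofNat.comp Primrec.snd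
  obtain ⟨F, hF, hF'⟩ : RatPrimrec fun x : ℕ × ℕ =>
      trapezoid (leftEnd x.1.unpair.1) (rightEnd x.1.unpair.1) x.1.unpair.2 (ratOfNat x.2) :=
    (RatPrimrec.const 0).max ((RatPrimrec.const 1).min
      ((RatPrimrec.two_pow_mul ht (hx.sub (ratPrimrec_leftEnd.comp hi))).min
        (RatPrimrec.two_pow_mul ht ((ratPrimrec_rightEnd.comp hi).sub hx))))
  obtain ⟨e, he, he'⟩ := exists_primrec_oracleCode (F := fun v y => F (v, y)) hF.to₂
    (s := fun v n => n + v.unpair.2)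
    (Primrec.nat_add.comp Primrec.snd (primrec_unpair_snd.comp Primrec.fst)).to₂
  refine ⟨fun x => e (Nat.pair x.1 x.2), he.comp (Primrec₂.natPair.comp Primrec.fst Primrec.snd),
    fun i t x ρ hρ => ⟨_, he' _ ρ, ?_, fun n => ?_⟩⟩
  · simp only [hF', trapezoid_cast, Nat.unpair_pair]
    exact ((continuous_trapezoid _ _ t).tendsto x).comp
      ((tendsto_add_atTop_iff_nat t).2 hρ.1)
  · simp only [hF', Nat.unpair_pair]
    -- the shift by `t` in the name of `x` compensates for the Lipschitz constant `2 ^ t`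
    refine (abs_trapezoid_sub_le _ _ _ _ _).trans_lt ?_
    have h := hρ.2 (n + t)
    rw [add_right_comm] at h
    calc _ < 2 ^ t * (1 / 2 : ℚ) ^ (n + t) := by gcongr
      _ = (1 / 2 : ℚ) ^ n := by
        rw [pow_add, mul_left_comm, ← mul_pow]
        norm_num

theorem ratInterval_subset_iff (i j : ℕ) : ratInterval i ⊆ ratInterval j ↔
    rightEnd i ≤ leftEnd i ∨ (leftEnd j ≤ leftEnd i ∧ rightEnd i ≤ rightEnd j) := by
  rw [ratInterval_eq, ratInterval_eq]
  rcases le_or_gt (rightEnd i) (leftEnd i) with h | h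
  · simp [h]
  · have h' : ((leftEnd i : ℚ) : ℝ) < ((rightEnd i : ℚ) : ℝ) := by exact_mod_cast h
    rw [Set.Ioo_subset_Ioo_iff h']
    simp [not_le.2 h]

theorem exists_computable_isSigmaIndex :
    ∃ d : ℕ → ℕ, Computable d ∧ ∀ j, IsSigmaIndex (d j) (ratInterval j) := by
  have hl := ratPrimrec_leftEnd
  have hr := ratPrimrec_rightEnd
  have h : PrimrecPred fun x : ℕ × ℕ => ratInterval x.2 ⊆ ratInterval x.1 := by
    simp only [ratInterval_subset_iff]
    exact ((hr.comp Primrec.snd).le (hl.comp Primrec.snd)).or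
      (((hl.comp Primrec.fst).le (hl.comp Primrec.snd)).and
        ((hr.comp Primrec.snd).le (hr.comp Primrec.fst)))
  obtain ⟨d, hd, hd'⟩ := exists_computable_isCEIndex h.rePred
  exact ⟨d, hd, fun j => ⟨isOpen_Ioo, hd' j⟩⟩

/-- Shrinking a rational interval by `2⁻ᵗ` at both ends is computable. -/
theorem exists_primrec_shrink : ∃ s : ℕ × ℕ → ℕ, Primrec s ∧ ∀ i t,
    leftEnd (s (i, t)) = leftEnd i + (1 / 2) ^ t ∧
      rightEnd (s (i, t)) = rightEnd i - (1 / 2) ^ t := by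
  have hp : RatPrimrec fun x : ℕ × ℕ => (1 / 2 : ℚ) ^ x.2 := RatPrimrec.half_pow Primrec.snd
  obtain ⟨f, hf, hf'⟩ := (ratPrimrec_leftEnd.comp Primrec.fst).add hp
  obtain ⟨g, hg, hg'⟩ := (ratPrimrec_rightEnd.comp Primrec.fst).sub hp
  refine ⟨fun x => Nat.pair (f x) (g x), Primrec₂.natPair.comp hf hg, fun i t => ?_⟩
  simp [leftEnd, rightEnd, hf', hg']

/-! ### Approximation of open sets by disjoint rational intervals -/

/-- The trace on a component `C` of an open set of a compact subset `K` of that set lies in a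
rational interval contained in `C`. -/
theorem exists_ratInterval_between {K C : Set ℝ} (hK : IsCompact K) (hKC : K ⊆ C) (hC : IsOpen C)
    (hC' : C.OrdConnected) : ∃ i, ratInterval i ⊆ C ∧ K ⊆ ratInterval i := by
  rcases K.eq_empty_or_nonempty with rfl | hne
  · obtain ⟨i, h1, h2⟩ := exists_ratInterval_eq 0 0
    exact ⟨i, by simp [ratInterval_eq, h1, h2], Set.empty_subset _⟩
  · obtain ⟨m, hm, hm'⟩ := hK.exists_isLeast hne
    obtain ⟨M, hM, hM'⟩ := hK.exists_isGreatest hne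
    obtain ⟨l, hl, hl'⟩ := exists_Ioc_subset_of_mem_nhds (hC.mem_nhds (hKC hm)) ⟨m - 1, by linarith⟩
    obtain ⟨u, hu, hu'⟩ := exists_Ico_subset_of_mem_nhds (hC.mem_nhds (hKC hM)) ⟨M + 1, by linarith⟩
    obtain ⟨a, ha, ha'⟩ := exists_rat_btwn hl
    obtain ⟨b, hb, hb'⟩ := exists_rat_btwn hu
    obtain ⟨i, h1, h2⟩ := exists_ratInterval_eq a b
    refine ⟨i, ?_, fun x hx => ?_⟩
    · rw [ratInterval_eq, h1, h2]
      exact Set.Ioo_subset_Icc_self.trans (hC'.out (hl' ⟨ha, ha'.le⟩) (hu' ⟨hb.le, hb'⟩))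
    · rw [ratInterval_eq, h1, h2]
      exact ⟨ha'.trans_le (hm' hx), (hM' hx).trans_lt hb⟩

/-- The compact sets inside an open set `U` meet only finitely many components of `U`, so the
measure of `U` is approximated by finitely many rational intervals, one in each of
these components. -/
theorem exists_pairwise_disjoint_ratInterval (ν : Measure ℝ) [IsFiniteMeasure ν] {U : Set ℝ}
    (hU : IsOpen U) {q : ℝ} (hq : q < ν.real U) :
    ∃ L : List ℕ, L.Pairwise (fun i j => Disjoint (ratInterval i) (ratInterval j)) ∧
      (∀ i ∈ L, ratInterval i ⊆ U) ∧ q < (L.map fun i => ν.real (ratInterval i)).sum := by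
  rcases lt_or_ge q 0 with h0 | h0
  · exact ⟨[], by simpa using h0⟩
  obtain ⟨K, hKU, hK, hqK⟩ := hU.exists_lt_isCompact
    ((ENNReal.ofReal_lt_iff_lt_toReal h0 (measure_ne_top ν U)).2 hq)
  replace hqK : q < ν.real K := (ENNReal.ofReal_lt_iff_lt_toReal h0 (measure_ne_top ν K)).1 hqK
  let 𝒞 : Set (Set ℝ) := {C | ∃ x ∈ U, connectedComponentIn U x = C}
  have hopen : ∀ C : 𝒞, IsOpen (C : Set ℝ) := by
    rintro ⟨_, x, hx, rfl⟩
    exact hU.connectedComponentIn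
  have hdisj : ∀ C C' : 𝒞, C ≠ C' → Disjoint (C : Set ℝ) (C' : Set ℝ) := by
    rintro ⟨_, x, hx, rfl⟩ ⟨_, y, hy, rfl⟩ hne
    refine Set.disjoint_left.2 fun z hz hz' => hne (Subtype.ext ?_)
    exact (connectedComponentIn_eq hz).trans (connectedComponentIn_eq hz').symm
  have hcover : K ⊆ ⋃ C : 𝒞, (C : Set ℝ) := fun x hx =>
    Set.mem_iUnion.2 ⟨⟨_, x, hKU hx, rfl⟩, mem_connectedComponentIn (hKU hx)⟩
  have hcompact : ∀ C : 𝒞, IsCompact (K ∩ C) := by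
    intro C
    have : K ∩ C = K \ ⋃ C' : {C' : 𝒞 // C' ≠ C}, (C' : Set ℝ) := by
      ext x
      refine and_congr_right fun hx => ⟨fun hC hx' => ?_, fun hx' => ?_⟩
      · obtain ⟨C', hC'⟩ := Set.mem_iUnion.1 hx'
        exact Set.disjoint_left.1 (hdisj _ _ C'.2) hC' hC
      · obtain ⟨C', hC'⟩ := Set.mem_iUnion.1 (hcover hx)
        by_cases h : C' = C
        · exact h ▸ hC'
        · exact absurd (Set.mem_iUnion.2 ⟨⟨C', h⟩, hC'⟩) hx'
    rw [this]
    exact hK.diff (isOpen_iUnion fun C' => hopen _)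
  have hord : ∀ C : 𝒞, (C : Set ℝ).OrdConnected := by
    rintro ⟨_, x, hx, rfl⟩
    exact isPreconnected_connectedComponentIn.ordConnected
  choose J hJ hJ' using fun C : 𝒞 => exists_ratInterval_between (hcompact C)
    Set.inter_subset_right (hopen C) (hord C)
  obtain ⟨t, ht⟩ := hK.elim_finite_subcover _ hopen hcover
  refine ⟨t.toList.map J, ?_, ?_, ?_⟩
  · rw [List.pairwise_map]
    exact t.nodup_toList.imp fun h => (hdisj _ _ h).mono (hJ _) (hJ _)
  · intro i hi
    obtain ⟨⟨_, x, hx, rfl⟩, -, rfl⟩ := List.mem_map.1 hi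
    exact (hJ _).trans (connectedComponentIn_subset U x)
  · have hKJ : K ⊆ ⋃ C ∈ t, ratInterval (J C) := by
      intro x hx
      obtain ⟨C, hC, hxC⟩ := Set.mem_iUnion₂.1 (ht hx)
      exact Set.mem_iUnion₂.2 ⟨C, hC, hJ' C ⟨hx, hxC⟩⟩
    rw [List.map_map]
    calc q < ν.real K := hqK
      _ ≤ ν.real (⋃ C ∈ t, ratInterval (J C)) := measureReal_mono hKJ (measure_ne_top ν _)
      _ ≤ ∑ C ∈ t, ν.real (ratInterval (J C)) := measureReal_biUnion_finset_le _ _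
      _ = _ := (Finset.sum_map_toList t _).symm

theorem sum_measureReal_le (ν : Measure ℝ) [IsFiniteMeasure ν] {L : List ℕ} {U : Set ℝ}
    (hL : L.Pairwise (fun i j => Disjoint (ratInterval i) (ratInterval j)))
    (hLU : ∀ i ∈ L, ratInterval i ⊆ U) :
    (L.map fun i => ν.real (ratInterval i)).sum ≤ ν.real U := by
  induction L generalizing U with
  | nil => simp
  | cons i L ih =>
    rw [List.pairwise_cons] at hL
    have hI : MeasurableSet (ratInterval i) := measurableSet_Ioo
    have h := ih (U := U \ ratInterval i) hL.2 fun j hj =>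
      Set.subset_sdiff.2 ⟨hLU j (List.mem_cons_of_mem _ hj), (hL.1 j hj).symm⟩
    rw [List.map_cons, List.sum_cons, ← measureReal_inter_add_sdiff (s := U) hI,
      Set.inter_eq_right.2 (hLU i List.mem_cons_self)]
    linarith

/-- A strict lower bound of a finite sum is witnessed by rational lower bounds of the terms. -/
theorem exists_rat_lt_of_lt_sum (f : ℕ → ℝ) (L : List ℕ) {q : ℝ} (hq : q < (L.map f).sum) :
    ∃ M : List (ℕ × ℕ), M.map Prod.fst = L ∧ (∀ x ∈ M, ((ratOfNat x.2 : ℚ) : ℝ) < f x.1) ∧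
      q < (((M.map fun x => ratOfNat x.2).sum : ℚ) : ℝ) := by
  induction L generalizing q with
  | nil => exact ⟨[], by simpa using hq⟩
  | cons i L ih =>
    rw [List.map_cons, List.sum_cons] at hq
    obtain ⟨p, hp, hp'⟩ := exists_rat_btwn (show q - (L.map f).sum < f i by linarith)
    obtain ⟨n, rfl⟩ := ratOfNat_surjective p
    obtain ⟨M, h1, h2, h3⟩ := ih (q := q - ratOfNat n) (by linarith)
    refine ⟨(i, n) :: M, by simp [h1], ?_, ?_⟩
    · simpa [hp'] using h2
    · rw [List.map_cons, List.sum_cons]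
      push_cast at h3 ⊢
      linarith

theorem primrecRel_disjoint_ratInterval :
    PrimrecRel fun i j => Disjoint (ratInterval i) (ratInterval j) := by
  have hl := ratPrimrec_leftEnd
  have hr := ratPrimrec_rightEnd
  refine PrimrecPred.of_eq (((hr.comp Primrec.fst).min (hr.comp Primrec.snd)).le
    ((hl.comp Primrec.fst).max (hl.comp Primrec.snd)) : PrimrecPred _) fun x => ?_
  beta_reduce
  rw [ratInterval_eq, ratInterval_eq, Set.Ioo_disjoint_Ioo]
  norm_cast

theorem primrecPred_pairwise {α : Type*} [Primcodable α] {R : α → α → Prop} (hR : PrimrecRel R) :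
    PrimrecPred fun L : List α => L.Pairwise R := by
  classical
  have h1 : PrimrecRel fun (L : List α) a => ∀ b ∈ L, R a b :=
    PrimrecRel.forall_mem_list (R := fun b a => R a b) hR.swap
  have h2 : Primrec fun L : List α => L.rec (motive := fun _ => Bool) true
      fun a l ih => decide (∀ b ∈ l, R a b) && ih :=
    Primrec.list_rec Primrec.id (Primrec.const true)
      (h := fun _ y => decide (∀ b ∈ y.2.1, R y.1 b) && y.2.2)
      (Primrec.and.comp ((h1.comp (Primrec.fst.comp Primrec.snd) Primrec.fst).decide.comp
        Primrec.snd) (Primrec.snd.comp (Primrec.snd.comp Primrec.snd)))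
  refine Primrec.primrecPred (h2.of_eq fun L => ?_)
  induction L with
  | nil => simp
  | cons a l ih => simp [ih, List.pairwise_cons]

/-! ### Computable measures from lower bounds on intervals -/

/-- If the lower bounds of the measures of the rational intervals can be enumerated, then the left
cut of the measure of a `Σ⁰₁` set is c.e. uniformly in an index of the set. -/
theorem exists_leftCut_of_rePred (ν : Measure ℝ) [IsFiniteMeasure ν]
    (hν : REPred fun x : ℕ × ℕ => ((ratOfNat x.2 : ℚ) : ℝ) < ν.real (ratInterval x.1)) :
    ∃ e, ∀ (u : ℕ) (U : Set ℝ), IsSigmaIndex u U →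
      ∃ d ∈ phi e u, IsLeftCutIndex d (ν.real U) := by
  have hp : REPred fun x : ℕ × ℕ => ∃ M : List (ℕ × ℕ),
      ((M.map Prod.fst).Pairwise (fun i j => Disjoint (ratInterval i) (ratInterval j)) ∧
        ratOfNat x.2 < (M.map fun y => ratOfNat y.2).sum) ∧
      ∀ y ∈ M, (phi x.1 y.1).Dom ∧ ((ratOfNat y.2 : ℚ) : ℝ) < ν.real (ratInterval y.1) := by
    refine REPred.exists (REPred.and ?_ ?_)
    · refine (PrimrecPred.and ?_ ?_).rePred
      · exact (primrecPred_pairwise primrecRel_disjoint_ratInterval).comp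
          (Primrec.list_map Primrec.snd (Primrec.fst.comp Primrec.snd).to₂)
      · exact (RatPrimrec.ofNat.comp (Primrec.snd.comp Primrec.fst)).lt
          ((RatPrimrec.ofNat.comp Primrec.snd).list_sum.comp Primrec.snd)
    · have h : REPred fun z : ℕ × (ℕ × ℕ) =>
          (phi z.1 z.2.1).Dom ∧ ((ratOfNat z.2.2 : ℚ) : ℝ) < ν.real (ratInterval z.2.1) :=
        ((partrec₂_phi.comp Computable.fst (Computable.fst.comp Computable.snd)).dom_re).and
          (hν.comp Computable.snd)
      exact h.forall_mem_list.comp ((Computable.fst.comp Computable.fst).pair Computable.snd)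
  obtain ⟨d, hd, hd'⟩ := exists_computable_isCEIndex hp
  obtain ⟨e, he⟩ := exists_isTotalIndex hd
  refine ⟨e, fun u U hU => ⟨d u, he u, fun n => (hd' u n).trans ?_⟩⟩
  simp only [Set.mem_ofPred_eq]
  constructor
  · rintro ⟨M, ⟨hM, hlt⟩, hM'⟩
    have h1 : (M.map fun y => ((ratOfNat y.2 : ℚ) : ℝ)).sum ≤
        (M.map fun y => ν.real (ratInterval y.1)).sum :=
      List.sum_le_sum fun y hy => (hM' y hy).2.le
    have h2 := sum_measureReal_le ν (U := U) hM fun i hi => by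
      obtain ⟨y, hy, rfl⟩ := List.mem_map.1 hi
      exact (hU.2 _).1 (hM' y hy).1
    rw [List.map_map] at h2
    have h3 : ((ratOfNat n : ℚ) : ℝ) < (((M.map fun y => ratOfNat y.2).sum : ℚ) : ℝ) := by
      exact_mod_cast hlt
    rw [Rat.cast_list_sum, List.map_map] at h3
    exact (h3.trans_le h1).trans_le h2
  · intro hn
    obtain ⟨L, hL, hLU, hsum⟩ := exists_pairwise_disjoint_ratInterval ν hU.1 hn
    obtain ⟨M, rfl, hM, hlt⟩ := exists_rat_lt_of_lt_sum _ L hsum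
    refine ⟨M, ⟨hL, by exact_mod_cast hlt⟩, fun y hy => ⟨(hU.2 _).2 ?_, hM y hy⟩⟩
    exact hLU _ (List.mem_map_of_mem hy)

/-! ### The limit measure -/

theorem IsTotalIndex.computable {e : ℕ} {g : ℕ → ℕ} (h : IsTotalIndex e g) : Computable g :=
  (partrec₂_phi.comp (Computable.const e) Computable.id).of_eq_tot h

theorem IsCauchyName.abs_sub_le {ρ : ℕ → ℕ} {x : ℝ} (h : IsCauchyName ρ x) (n : ℕ) :
    |((ratOfNat (ρ n) : ℚ) : ℝ) - x| ≤ 2 * (1 / 2) ^ n := by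
  have h' := dist_le_of_le_geometric_two_of_tendsto (C := 2) (fun n => by
    have : |((ratOfNat (ρ n) : ℚ) : ℝ) - (ratOfNat (ρ (n + 1)) : ℚ)| < (1 / 2) ^ n := by
      have := (Rat.cast_lt (K := ℝ)).2 (h.2 n)
      push_cast at this
      exact this
    rw [Real.dist_eq]
    refine this.le.trans_eq ?_
    simp) h.1 n
  rw [Real.dist_eq] at h'
  refine h'.trans_eq ?_
  simp [div_eq_mul_inv]

theorem exists_isFunctionIndex_one : ∃ e, IsFunctionIndex e fun _ => 1 := by
  obtain ⟨c, hc⟩ := ratOfNat_surjective 1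
  obtain ⟨e, -, he⟩ := exists_primrec_oracleCode (F := fun _ _ => c) (Primrec₂.const c)
    (s := fun _ n => n) Primrec₂.right
  refine ⟨e 0, fun x ρ _ => ⟨_, he 0 ρ, ?_, fun n => ?_⟩⟩
  · simp [hc]
  · simp

theorem trapezoid_mem_boundedComputable (i t : ℕ) :
    trapezoid ((leftEnd i : ℚ) : ℝ) ((rightEnd i : ℚ) : ℝ) t ∈ BoundedComputable := by
  obtain ⟨e, -, he⟩ := exists_primrec_isFunctionIndex
  exact ⟨⟨_, he i t⟩, 1, abs_trapezoid_le_one _ _ t⟩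

section Limit

variable {μs : ℕ → Measure ℝ} {μ : Measure ℝ}

/-- The strict lower bounds of `μₙ(I)` are enumerable, uniformly in `n` and the rational
interval `I`. -/
theorem UniformlyComputable.rePred_lt_measure (hcomp : UniformlyComputable μs) :
    REPred fun x : (ℕ × ℕ) × ℕ =>
      ((ratOfNat x.2 : ℚ) : ℝ) < (μs x.1.1).real (ratInterval x.1.2) := by
  obtain ⟨g, hg, hg'⟩ := hcomp
  obtain ⟨d, hd, hd'⟩ := exists_computable_isSigmaIndex
  have hb : Partrec fun x : ℕ × ℕ => phi (g x.1).unpair.2 (d x.2) :=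
    partrec₂_phi.comp (primrec_unpair_snd.to_comp.comp (hg.comp Computable.fst))
      (hd.comp Computable.snd)
  have hf : Partrec fun x : (ℕ × ℕ) × ℕ =>
      (phi (g x.1.1).unpair.2 (d x.1.2)).bind fun c => phi c x.2 :=
    Partrec.bind (hb.comp Computable.fst)
      (partrec₂_phi.comp Computable.snd (Computable.snd.comp Computable.fst)).to₂
  refine hf.dom_re.of_eq fun ⟨⟨n, i⟩, p⟩ => ?_
  obtain ⟨c, hc, hcut⟩ := (hg' n).2 _ _ (hd' i)
  rw [Part.eq_some_iff.2 hc, Part.bind_some]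
  exact hcut p

/-- The moduli of convergence of the integrals of the rational trapezoidal functions are uniformly
computable. -/
theorem EffectivelyWeaklyConverges.exists_computable_modulus
    (hconv : EffectivelyWeaklyConverges μs μ) :
    ∃ G : ℕ × ℕ → ℕ → ℕ, Computable₂ G ∧ ∀ i t, IsModulus (G (i, t))
      (fun n => ∫ x, trapezoid ((leftEnd i : ℚ) : ℝ) ((rightEnd i : ℚ) : ℝ) t x ∂(μs n))
      (∫ x, trapezoid ((leftEnd i : ℚ) : ℝ) ((rightEnd i : ℚ) : ℝ) t x ∂μ) := by
  obtain ⟨-, h, hh, hh'⟩ := hconv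
  obtain ⟨e, he, he'⟩ := exists_primrec_isFunctionIndex
  choose m hm G hG hG' using fun i t => hh' _ (trapezoid_mem_boundedComputable i t) _ 1 (he' i t)
    (by simpa using abs_trapezoid_le_one _ _ t)
  refine ⟨fun x => G x.1 x.2, ?_, hG'⟩
  have hf : Partrec fun y : (ℕ × ℕ) × ℕ => (h (e y.1, 1)).bind fun m => phi m y.2 :=
    Partrec.bind (hh.comp ((he.to_comp.comp Computable.fst).pair (Computable.const 1)))
      (partrec₂_phi.comp Computable.snd (Computable.snd.comp Computable.fst)).to₂
  exact hf.of_eq_tot fun y => Part.mem_bind (hm _ _) (hG _ _ _)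

/-- The lower bounds of the measures of the rational intervals are enumerable for an effective weak
limit. The bound `p < μ(I)` is certified by a number `n` past the modulus of the integrals of a
trapezoidal function supported in `I` at precision `2⁻ᵏ` and by an enumerated
inequality `p + 2⁻ᵏ < μₙ(J)`, where `J` is the plateau of that function. -/
theorem rePred_lt_measure_ratInterval [∀ n, IsFiniteMeasure (μs n)] [IsFiniteMeasure μ]
    (hcomp : UniformlyComputable μs)
    (hconv : EffectivelyWeaklyConverges μs μ) :
    REPred fun x : ℕ × ℕ => ((ratOfNat x.2 : ℚ) : ℝ) < μ.real (ratInterval x.1) := by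
  obtain ⟨G, hG, hG'⟩ := hconv.exists_computable_modulus
  obtain ⟨s, hs, hs'⟩ := exists_primrec_shrink
  obtain ⟨r, hr, hr'⟩ : RatPrimrec fun y : ℕ × ℕ => ratOfNat y.1 + (1 / 2 : ℚ) ^ y.2 :=
    (RatPrimrec.ofNat.comp Primrec.fst).add (RatPrimrec.half_pow Primrec.snd)
  have hshrink : ∀ i t, ratInterval (s (i, t)) = Set.Ioo (((leftEnd i : ℚ) : ℝ) + (1 / 2) ^ t)
      (((rightEnd i : ℚ) : ℝ) - (1 / 2) ^ t) := fun i t => by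
    rw [ratInterval_eq, (hs' i t).1, (hs' i t).2]
    push_cast
    rfl
  have hre : REPred fun x : ℕ × ℕ => ∃ w : ℕ × ℕ × ℕ, G (x.1, w.1) w.2.1 ≤ w.2.2 ∧
      ((ratOfNat (r (x.2, w.2.1)) : ℚ) : ℝ) < (μs w.2.2).real (ratInterval (s (x.1, w.1))) := by
    have hx : Computable fun z : (ℕ × ℕ) × ℕ × ℕ × ℕ => z.1.1 :=
      Computable.fst.comp Computable.fst
    have hp : Computable fun z : (ℕ × ℕ) × ℕ × ℕ × ℕ => z.1.2 :=
      Computable.snd.comp Computable.fst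
    have ht : Computable fun z : (ℕ × ℕ) × ℕ × ℕ × ℕ => z.2.1 :=
      Computable.fst.comp Computable.snd
    have hk : Computable fun z : (ℕ × ℕ) × ℕ × ℕ × ℕ => z.2.2.1 :=
      Computable.fst.comp (Computable.snd.comp Computable.snd)
    have hn : Computable fun z : (ℕ × ℕ) × ℕ × ℕ × ℕ => z.2.2.2 :=
      Computable.snd.comp (Computable.snd.comp Computable.snd)
    have hle : REPred fun y : ℕ × ℕ => y.1 ≤ y.2 := Primrec.nat_le.rePred
    have h1 := hle.comp ((hG.comp (hx.pair ht) hk).pair hn)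
    have h2 := hcomp.rePred_lt_measure.comp
      ((hn.pair (hs.to_comp.comp (hx.pair ht))).pair (hr.to_comp.comp (hp.pair hk)))
    exact REPred.exists (h1.and h2)
  refine hre.of_eq fun ⟨i, p⟩ => ?_
  simp only [Prod.exists, hr', Rat.cast_add, Rat.cast_pow, Rat.cast_div, Rat.cast_one,
    Rat.cast_ofNat]
  constructor
  · rintro ⟨t, k, n, hn, hlt⟩
    rw [hshrink] at hlt
    have h1 := measureReal_le_integral_trapezoid (μs n) ((leftEnd i : ℚ) : ℝ) (rightEnd i : ℚ) t
    have h2 := (abs_lt.1 (hG' i t k n hn)).2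
    have h3 := integral_trapezoid_le μ ((leftEnd i : ℚ) : ℝ) (rightEnd i : ℚ) t
    rw [ratInterval_eq]
    linarith
  · intro hp
    rw [ratInterval_eq] at hp
    obtain ⟨t, ht⟩ := exists_lt_measureReal_Ioo μ _ _ hp
    rw [← hshrink, ratInterval_eq] at ht
    -- a second trapezoid, supported in the plateau `J` of the first one, bounds `μₙ(J)` from below
    obtain ⟨t', ht'⟩ := exists_lt_measureReal_Ioo μ _ _ ht
    replace ht' := ht'.trans_le (measureReal_le_integral_trapezoid μ _ _ t')
    obtain ⟨k, hk⟩ := exists_pow_lt_of_lt_one (sub_pos.2 ht') (by norm_num : (1 / 2 : ℝ) < 1)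
    obtain ⟨n, hn, hn'⟩ := (((hconv.1 _ (trapezoid_mem_boundedComputable (s (i, t))
      t')).eventually_const_lt (lt_sub_iff_add_lt'.1 hk)).and
        (eventually_ge_atTop (G (i, t) k))).exists
    exact ⟨t, k, n, hn', hn.trans_le (integral_trapezoid_le (μs n) _ _ t')⟩

/-- The total mass is the integral of the constant function `1`, so a Cauchy name of the limit is
read off the names of the masses `μₙ(ℝ)` along the modulus of convergence. -/
theorem exists_isRealIndex_measure_univ (hcomp : UniformlyComputable μs)
    (hconv : EffectivelyWeaklyConverges μs μ) : ∃ e, IsRealIndex e (μ.real Set.univ) := by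
  obtain ⟨g, hg, hg'⟩ := hcomp
  obtain ⟨-, h, -, hh⟩ := hconv
  obtain ⟨e, he⟩ := exists_isFunctionIndex_one
  obtain ⟨m, -, G, hG, hG'⟩ := hh _ ⟨⟨e, he⟩, 1, by simp⟩ e 1 he (by simp)
  simp only [integral_const, smul_eq_mul, mul_one] at hG'
  choose ρ hρ hρ' using fun n => (hg' n).1
  have hcρ : Computable fun x : ℕ × ℕ => ρ x.1 x.2 :=
    (partrec₂_phi.comp (primrec_unpair_fst.to_comp.comp (hg.comp Computable.fst))
      Computable.snd).of_eq_tot fun x => hρ x.1 x.2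
  have hadd : Computable fun k : ℕ => k + 3 :=
    (Primrec.nat_add.comp Primrec.id (Primrec.const 3)).to_comp
  obtain ⟨a, ha⟩ := exists_isTotalIndex (hcρ.comp ((hG.computable.comp hadd).pair hadd))
  -- `2 * 2⁻⁽ᵏ⁺³⁾` comes from the name of `μₙ(ℝ)` and `2⁻⁽ᵏ⁺³⁾` from the modulus
  have hest : ∀ k, |((ratOfNat (ρ (G (k + 3)) (k + 3)) : ℚ) : ℝ) - μ.real Set.univ| ≤
      3 / 8 * (1 / 2) ^ k := by
    intro k
    have h1 := (hρ' (G (k + 3))).abs_sub_le (k + 3)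
    have h2 := hG' (k + 3) (G (k + 3)) le_rfl
    refine (abs_sub_le _ ((μs (G (k + 3))).real Set.univ) _).trans
      ((add_le_add h1 h2.le).trans_eq ?_)
    rw [pow_add]
    ring
  refine ⟨a, _, ha, ?_, fun k => ?_⟩
  · rw [tendsto_iff_dist_tendsto_zero]
    refine squeeze_zero (fun _ => dist_nonneg) hest ?_
    simpa using (tendsto_pow_atTop_nhds_zero_of_lt_one (r := (1 / 2 : ℝ)) (by norm_num)
      (by norm_num)).const_mul (3 / 8)
  · have h1 := hest k
    have h2 := hest (k + 1)
    rw [abs_sub_comm] at h2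
    have h3 := (abs_sub_le _ _ _).trans (add_le_add h1 h2)
    have h4 : (0 : ℝ) < (1 / 2) ^ k := by positivity
    have h5 : |((ratOfNat (ρ (G (k + 3)) (k + 3)) : ℚ) : ℝ) -
        (ratOfNat (ρ (G (k + 1 + 3)) (k + 1 + 3)) : ℚ)| < (1 / 2) ^ k := by
      refine h3.trans_lt ?_
      rw [pow_succ]
      linarith
    rw [← Rat.cast_lt (K := ℝ)]
    push_cast
    exact h5

end Limit

end EffWeak

theorem proposition4p4 (μs : ℕ → MeasureTheory.Measure ℝ)
    [∀ n, MeasureTheory.IsFiniteMeasure (μs n)]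
    (μ : MeasureTheory.Measure ℝ) [MeasureTheory.IsFiniteMeasure μ]
    (hcomp : EffWeak.UniformlyComputable μs)
    (hconv : EffWeak.EffectivelyWeaklyConverges μs μ) :
    EffWeak.ComputableMeasure μ := by
  obtain ⟨a, ha⟩ := EffWeak.exists_isRealIndex_measure_univ hcomp hconv
  obtain ⟨b, hb⟩ := EffWeak.exists_leftCut_of_rePred μ
    (EffWeak.rePred_lt_measure_ratInterval hcomp hconv)
  exact ⟨Nat.pair a b, by simpa using ha, by simpa using hb⟩
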